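/- Let $\mathbb X,\mathbb U$ be standard Borel spaces, $\mathcal U$ a multifunction assigning to each $x\in\mathbb X$ a nonempty set $\mathcal U(x)\subset\mathbb U$ of admissible actions with measurable graph $\mathbb K=\{(x,u):u\in\mathcal U(x)\}$, and $\mathcal T(\cdot\,|\,x,u)$ a stochastic kernel from $\mathbb K$ to $\mathbb X$. A stationary policy is a stochastic kernel $\gamma(du|x)$ with $\gamma(\mathcal U(x)|x)=1$ for all $x$; the set $\Gamma_S$ of stationary policies is assumed nonempty. Put $\mathcal T^\gamma(A|x)=\int_{\mathcal U(x)}\mathcal T(A|x,u)\,\gamma(du|x)$ and $$\mathcal G=\{\mu\in\mathcal P(\mathbb K):\ \mu((B\times\mathbb U)\cap\mathbb K)=\int\mathcal T(B|x,u)\,\mu(dx,du)\ \text{ for all Borel } B\subset\mathbb X\},$$ and let $\mathcal G_e$ be the set of extreme points of $\mathcal G$. If $\pi$ is an invariant probability measure of $\mathcal T^\gamma$, then $\gamma$ is called $\pi$-deterministic if $\gamma(\cdot|x)$ is a Dirac measure for $\pi$-a.e. $x$, and $\pi$-randomized otherwise. A set $C$ is $1$-small for a kernel $P$ if there is a nonzero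 measure $\nu$ with $P(x,D)\ge\nu(D)$ for all $x\in C$ and Borel $D$. Assume the following two conditions. 1. (Small sets.) For every $\gamma\in\Gamma_S$ the chain with kernel $\mathcal T^\gamma$ is irreducible, with maximal irreducibility measure $\psi_\gamma$. For all $\gamma^1,\gamma^2\in\Gamma_S$ and every Borel $B$ with $\psi_{\gamma^i}(B)>0$, $i=1,2$, there is a measurable $C\subset B$ that is $1$-small for both $\mathcal T^{\gamma^1}$ and $\mathcal T^{\gamma^2}$ and satisfies $\psi_{\gamma^i}(C)>0$, $i=1,2$. 2. (Realizability.) For every $\phi\in\Gamma_S$ that is $\pi$-randomized for some invariant probability measure $\pi$ of $\mathcal T^\phi$ there are: policies $\phi^1,\phi^2\in\Gamma_S$, a Borel set $B$ and a measurable $\kappa$ such that, for all $x\in B$, $\kappa(x)\in(0,1)$, $\phi^1(\cdot|x)\ne\phi^2(\cdot|x)$ and $\phi(\cdot|x)=\kappa(x)\phi^1(\cdot|x)+(1-\kappa(x))\phi^2(\cdot|x)$; a measurable $C\subset B$ and nonzero measures $\nu^1,\nu^2$ of equal total mass with $\mathcal T^{\phi^i}(D|x)\ge\nu^i(D)$ for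 all $x\in C$, Borel $D$ and $i=1,2$; and $K\in(0,\tfrac12)$ such that $C^K=\{x\in C: K\le\kappa(x)\le 1-K\}$ satisfies $\psi_{\phi^i}(C^K)>0$, $i=1,2$; for which there exist $\psi^1,\psi^2\in\Gamma_S$ with, for all $x\in C^K$, $$\mathcal T^{\psi^1}(\cdot|x)=\kappa(x)\mathcal T^{\phi^1}(\cdot|x)+(1-\kappa(x))\mathcal T^{\phi^2}(\cdot|x)+K\nu^1-K\nu^2,$$ $$\mathcal T^{\psi^2}(\cdot|x)=\kappa(x)\mathcal T^{\phi^1}(\cdot|x)+(1-\kappa(x))\mathcal T^{\phi^2}(\cdot|x)-K\nu^1+K\nu^2 .$$ Then no randomized stationary policy induces an extreme point of $\mathcal G$: if $\phi\in\Gamma_S$, $\pi$ is an invariant probability measure of $\mathcal T^\phi$ and $\phi$ is $\pi$-randomized, then the measure $\phi(du|x)\,\pi(dx)$ is not in $\mathcal G_e$. Consequently every $\mu\in\mathcal G_e$ is induced by a deterministic policy: there are $\gamma\in\Gamma_S$ and an invariant probability measure $\pi$ of $\mathcal T^\gamma$ such that $\gamma$ is $\pi$-deterministic and $\mu(dx,du)=\gamma(du|x)\,\pi(dx)$.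 -/

import Mathlib

open MeasureTheory ProbabilityTheory
open scoped ENNReal NNReal

/-- A controlled Markov chain on the state space `X` with action space `U`. The running cost, which
plays no role for the set of invariant occupation measures, is left out. -/
structure ControlledMarkovChain (X U : Type*) [MeasurableSpace X] [MeasurableSpace U] where
  /-- The multifunction sending a state to its set of admissible actions. -/
  admissible : X → Set U
  strict : ∀ x, (admissible x).Nonempty
  measurableSet_graph : MeasurableSet {p : X × U | p.2 ∈ admissible p.1}
  /-- The transition kernel, defined on the admissible state/action pairs. -/
  trans : Kernel ({p : X × U | p.2 ∈ admissible p.1} : Set (X × U)) X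
  isMarkovKernel_trans : IsMarkovKernel trans

namespace ControlledMarkovChain

variable {X U : Type*} [MeasurableSpace X] [MeasurableSpace U]

/-- The set of admissible state/action pairs. -/
abbrev Pairs (M : ControlledMarkovChain X U) : Type _ :=
  ({p : X × U | p.2 ∈ M.admissible p.1} : Set (X × U))

/-- A (possibly randomized) stationary policy: a stochastic kernel from states to actions that
charges only admissible actions. -/
structure StationaryPolicy (M : ControlledMarkovChain X U) where
  kernel : Kernel X U
  isMarkovKernel : IsMarkovKernel kernel
  apply_admissible : ∀ x, kernel x (M.admissible x) = 1

variable (M : ControlledMarkovChain X U)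

/-- The kernel `x ↦ δ_x ⊗ γ(·|x)`, regarded as a kernel into the admissible state/action pairs. -/
noncomputable def StationaryPolicy.pairKernel {M : ControlledMarkovChain X U}
    (γ : M.StationaryPolicy) : Kernel X M.Pairs :=
  Kernel.comapRight (Kernel.id ×ₖ γ.kernel)
    (MeasurableEmbedding.subtype_coe M.measurableSet_graph)

/-- The transition kernel `T^γ(A|x) = ∫ T(A|x,u) γ(du|x)` of the state process under `γ`. -/
noncomputable def StationaryPolicy.stateKernel {M : ControlledMarkovChain X U}
    (γ : M.StationaryPolicy) : Kernel X X :=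
  M.trans ∘ₖ γ.pairKernel

/-- The measure `γ(du|x) π(dx)` on the admissible state/action pairs. -/
noncomputable def StationaryPolicy.occupation {M : ControlledMarkovChain X U}
    (γ : M.StationaryPolicy) (π : Measure X) : Measure M.Pairs :=
  π.bind γ.pairKernel

/-- `π` is an invariant probability measure of the chain under `γ`. -/
def StationaryPolicy.IsInvariantProb {M : ControlledMarkovChain X U}
    (γ : M.StationaryPolicy) (π : Measure X) : Prop :=
  IsProbabilityMeasure π ∧ Kernel.Invariant γ.stateKernel π

/-- `γ` is `π`-deterministic: `γ(·|x)` is a Dirac mass for `π`-almost every `x`. -/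
def StationaryPolicy.IsDeterministic {M : ControlledMarkovChain X U}
    (γ : M.StationaryPolicy) (π : Measure X) : Prop :=
  ∀ᵐ x ∂π, ∃ u, γ.kernel x = Measure.dirac u

/-- `γ` is `π`-randomized. -/
def StationaryPolicy.IsRandomized {M : ControlledMarkovChain X U}
    (γ : M.StationaryPolicy) (π : Measure X) : Prop :=
  ¬ γ.IsDeterministic π

/-- The set of invariant occupation measures: the probability measures `μ` on the admissible
pairs whose state marginal equals `μT`. -/
def invariantOccupationMeasures : Set (Measure M.Pairs) :=
  {μ | IsProbabilityMeasure μ ∧ ∀ B : Set X, MeasurableSet B →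
    μ {p | p.1.1 ∈ B} = ∫⁻ p, M.trans p B ∂μ}

/-- The set of extreme points of the set of invariant occupation measures. -/
def extremeOccupationMeasures : Set (Measure M.Pairs) :=
  M.invariantOccupationMeasures.extremePoints ℝ≥0

end ControlledMarkovChain

namespace MarkovKernel

variable {X : Type*} [MeasurableSpace X]

/-- `ψ` is an irreducibility measure of the kernel `P`. -/
def IsIrreducibilityMeasure (P : Kernel X X) (ψ : Measure X) : Prop :=
  SigmaFinite ψ ∧ ψ ≠ 0 ∧ Kernel.IsIrreducible ψ P

/-- `ψ` is a maximal irreducibility measure of `P`. Any two such measures have the same null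
sets. -/
def IsMaximalIrreducibilityMeasure (P : Kernel X X) (ψ : Measure X) : Prop :=
  IsIrreducibilityMeasure P ψ ∧ ∀ φ : Measure X, IsIrreducibilityMeasure P φ → φ ≪ ψ

/-- `P` is irreducible and `B` has positive maximal irreducibility measure. -/
def HasPosIrreducibilityMeasure (P : Kernel X X) (B : Set X) : Prop :=
  ∃ ψ : Measure X, IsMaximalIrreducibilityMeasure P ψ ∧ 0 < ψ B

/-- `P ^ n` is minorized on `A` by the positive measure `ν`. -/
def IsMinorizedOn (P : Kernel X X) (n : ℕ) (A : Set X) (ν : Measure X) : Prop :=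
  ν ≠ 0 ∧ ∀ x ∈ A, ∀ D : Set X, MeasurableSet D → ν D ≤ (P ^ n) x D

/-- The set `A` is `n`-small for `P`. -/
def IsSmall (P : Kernel X X) (n : ℕ) (A : Set X) : Prop :=
  MeasurableSet A ∧ ∃ ν : Measure X, IsMinorizedOn P n A ν

end MarkovKernel

namespace ControlledMarkovChain

open MarkovKernel

variable {X U : Type*} [MeasurableSpace X] [MeasurableSpace U]

/-- The `1`-small set condition: under every stationary policy the chain is irreducible, and for any
two stationary policies every Borel set of positive maximal irreducibility measure under both
contains a measurable set that is `1`-small and of positive maximal irreducibility measure under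
both. -/
def SmallSetCondition (M : ControlledMarkovChain X U) : Prop :=
  (∀ γ : M.StationaryPolicy, ∃ ψ : Measure X, IsMaximalIrreducibilityMeasure γ.stateKernel ψ) ∧
  ∀ γ₁ γ₂ : M.StationaryPolicy, ∀ B : Set X, MeasurableSet B →
    HasPosIrreducibilityMeasure γ₁.stateKernel B →
    HasPosIrreducibilityMeasure γ₂.stateKernel B →
    ∃ C ⊆ B, MeasurableSet C ∧
      IsSmall γ₁.stateKernel 1 C ∧ IsSmall γ₂.stateKernel 1 C ∧
      HasPosIrreducibilityMeasure γ₁.stateKernel C ∧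
      HasPosIrreducibilityMeasure γ₂.stateKernel C

/-- The data of the split-chain construction for the policy `φ`. -/
structure SplitData {M : ControlledMarkovChain X U} (φ : M.StationaryPolicy) where
  /-- The two policies between which `φ` randomizes on `B`, with weights `κ` and `1 - κ`. -/
  φ₁ : M.StationaryPolicy
  φ₂ : M.StationaryPolicy
  κ : X → ℝ
  B : Set X
  measurable_κ : Measurable κ
  measurableSet_B : MeasurableSet B
  κ_mem : ∀ x ∈ B, κ x ∈ Set.Ioo (0 : ℝ) 1
  φ_eq : ∀ x ∈ B, φ.kernel x =
    ENNReal.ofReal (κ x) • φ₁.kernel x + ENNReal.ofReal (1 - κ x) • φ₂.kernel x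
  φ_ne : ∀ x ∈ B, φ₁.kernel x ≠ φ₂.kernel x
  /-- A subset of `B` that is `1`-small under both policies, with minorizing measures `ν₁` and `ν₂`
  of equal mass. -/
  C : Set X
  ν₁ : Measure X
  ν₂ : Measure X
  C_subset : C ⊆ B
  measurableSet_C : MeasurableSet C
  minorized₁ : IsMinorizedOn φ₁.stateKernel 1 C ν₁
  minorized₂ : IsMinorizedOn φ₂.stateKernel 1 C ν₂
  mass_eq : ν₁ Set.univ = ν₂ Set.univ
  /-- The level at which the weight is truncated. -/
  K : ℝ
  K_mem : K ∈ Set.Ioo (0 : ℝ) (1 / 2)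
  pos₁ : HasPosIrreducibilityMeasure φ₁.stateKernel {x ∈ C | K ≤ κ x ∧ κ x ≤ 1 - K}
  pos₂ : HasPosIrreducibilityMeasure φ₂.stateKernel {x ∈ C | K ≤ κ x ∧ κ x ≤ 1 - K}

/-- The set `C^K = {x ∈ C : K ≤ κ(x) ≤ 1 - K}` that is split. -/
def SplitData.splitSet {M : ControlledMarkovChain X U} {φ : M.StationaryPolicy}
    (d : SplitData φ) : Set X :=
  {x ∈ d.C | d.K ≤ d.κ x ∧ d.κ x ≤ 1 - d.K}

/-- There are stationary policies whose transition kernels on `C^K` are the two aggregate kernels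
`κ T^{φ₁} + (1 - κ) T^{φ₂} ± K (ν₁ - ν₂)` of the split chain. -/
def SplitData.Realizable {M : ControlledMarkovChain X U} {φ : M.StationaryPolicy}
    (d : SplitData φ) : Prop :=
  ∃ ψ₁ ψ₂ : M.StationaryPolicy, ∀ x ∈ d.splitSet, ∀ A : Set X, MeasurableSet A →
    (ψ₁.stateKernel x).real A =
      d.κ x * (d.φ₁.stateKernel x).real A + (1 - d.κ x) * (d.φ₂.stateKernel x).real A
        + d.K * d.ν₁.real A - d.K * d.ν₂.real A ∧
    (ψ₂.stateKernel x).real A =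
      d.κ x * (d.φ₁.stateKernel x).real A + (1 - d.κ x) * (d.φ₂.stateKernel x).real A
        - d.K * d.ν₁.real A + d.K * d.ν₂.real A

/-- The realizability condition: every stationary policy that is randomized with respect to one of
its invariant probability measures admits a splitting whose aggregate kernels are realizable. -/
def RealizabilityCondition (M : ControlledMarkovChain X U) : Prop :=
  ∀ (φ : M.StationaryPolicy) (π : Measure X), φ.IsInvariantProb π → φ.IsRandomized π →
    ∃ d : SplitData φ, d.Realizable

end ControlledMarkovChain

/-! Let `μ = γ(du|x)π(dx)` be extreme, `P = T^γ`, and let `ν` minorize `P` on a small set `C` of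
positive irreducibility measure. With the residual kernel `R = P - 1_C ⊗ ν`, irreducibility gives `π
= π(C) ∑ₙ Rⁿν` (`Invariant.eq_smul_potential`).

Fix a measurable `V ⊆ U` and one generation `ρ = Rⁿν`. The parts of `γ(du|x)ρ(dx)` with densities
`1_V(u) γ(Vᶜ|x)` and `1_{Vᶜ}(u) γ(V|x)` (`splitPart`) have the same state marginal. Let each make
one transition and then evolve under `R`, with `γ` choosing the actions. Mass leaves `R` only by
regenerating as `ν`, so both return the same multiple of `ν`. The two resulting measures thus have
the same defect in the balance equation, and both lie below a multiple of `μ`; by extremality their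
difference is a multiple of `μ` (`smul_add_eq_smul_add`).

Comparing state marginals and lifting back through `γ` cancels everything except the two split
parts, which must therefore coincide. They sit on disjoint sets of actions, so `γ(V|x) γ(Vᶜ|x) = 0`
for `ρ`-a.e. `x` (`ae_pow_kernel_eq_zero_or`). Summing over `n` gives this `π`-a.e.; a countable
generating family of sets `V` makes `γ(·|x)` a zero-one measure, hence Dirac. The second claim
follows by disintegration (`exists_occupation_eq`). -/

namespace MeasureTheory.Measure

variable {X Y : Type*} [MeasurableSpace X] [MeasurableSpace Y]

/-! ### Measures: composition with kernels, zero-one laws. -/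

lemma comp_mono_right (κ : Kernel X Y) {μ ν : Measure X} (h : μ ≤ ν) : κ ∘ₘ μ ≤ κ ∘ₘ ν := by
  refine Measure.le_iff.2 fun s hs ↦ ?_
  rw [Measure.bind_apply hs κ.aemeasurable, Measure.bind_apply hs κ.aemeasurable]
  exact lintegral_mono' h le_rfl

lemma comp_univ_of_isMarkovKernel (κ : Kernel X Y) [IsMarkovKernel κ] (μ : Measure X) :
    (κ ∘ₘ μ) Set.univ = μ Set.univ := by
  rw [Measure.bind_apply MeasurableSet.univ κ.aemeasurable]
  simp

/-- The sets that are null or co-null form a σ-algebra, so generators suffice. -/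
lemma isZeroOneMeasure_of_generateFrom {μ : Measure X} [IsProbabilityMeasure μ] {S : Set (Set X)}
    (hS : (‹MeasurableSpace X› : MeasurableSpace X) = MeasurableSpace.generateFrom S)
    (h : ∀ s ∈ S, μ s = 0 ∨ μ sᶜ = 0) : IsZeroOneMeasure μ := by
  have key : ∀ s, MeasurableSet s → μ s = 0 ∨ μ sᶜ = 0 := by
    intro s hs
    rw [hS] at hs
    induction s, hs using MeasurableSpace.generateFrom_induction with
    | hC t ht _ => exact h t ht
    | empty => simp
    | compl t _ ih => rw [compl_compl]; exact ih.symm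
    | iUnion s _ ih =>
      by_cases h0 : ∀ n, μ (s n) = 0
      · exact .inl (measure_iUnion_null h0)
      · push Not at h0
        obtain ⟨n, hn⟩ := h0
        refine .inr (measure_mono_null ?_ ((ih n).resolve_left hn))
        exact Set.compl_subset_compl.2 (Set.subset_iUnion s n)
  refine ⟨fun s hs ↦ (key s hs).imp id fun h0 ↦ ?_⟩
  rwa [prob_compl_eq_zero_iff hs] at h0

end MeasureTheory.Measure

/-! ### Potentials, residual kernels and the regenerative representation. -/

namespace ProbabilityTheory.Kernel

variable {X : Type*} [MeasurableSpace X]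

/-- The potential `∑ₙ ρ Rⁿ` of the measure `ρ` under the kernel `R`. -/
noncomputable def potential (R : Kernel X X) (ρ : Measure X) : Measure X :=
  Measure.sum fun n : ℕ ↦ (R ^ n : Kernel X X) ∘ₘ ρ

variable {P R : Kernel X X} {ρ ρ' ν : Measure X}

lemma potential_add (R : Kernel X X) (ρ ρ' : Measure X) :
    R.potential (ρ + ρ') = R.potential ρ + R.potential ρ' := by
  simp [potential, Measure.sum_add_sum]

lemma potential_smul (R : Kernel X X) (c : ℝ≥0∞) (ρ : Measure X) :
    R.potential (c • ρ) = c • R.potential ρ := by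
  ext s hs
  simp [potential, Measure.sum_apply _ hs, ENNReal.tsum_mul_left]

lemma potential_mono (R : Kernel X X) (h : ρ ≤ ρ') : R.potential ρ ≤ R.potential ρ' := by
  refine Measure.le_iff.2 fun s hs ↦ ?_
  simp only [potential, Measure.sum_apply _ hs]
  exact ENNReal.tsum_le_tsum fun n ↦ Measure.comp_mono_right _ h s

lemma pow_succ_comp_measure (R : Kernel X X) (n : ℕ) (ρ : Measure X) :
    (R ^ (n + 1) : Kernel X X) ∘ₘ ρ = R ∘ₘ ((R ^ n : Kernel X X) ∘ₘ ρ) := by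
  rw [Measure.comp_assoc, pow_succ']; rfl

lemma pow_zero_comp_measure (R : Kernel X X) (ρ : Measure X) : (R ^ 0 : Kernel X X) ∘ₘ ρ = ρ := by
  rw [pow_zero]; exact Measure.bind_dirac

lemma pow_le_potential (R : Kernel X X) (n : ℕ) (ρ : Measure X) :
    (R ^ n : Kernel X X) ∘ₘ ρ ≤ R.potential ρ := Measure.le_sum (fun n : ℕ ↦ (R ^ n : Kernel X X) ∘ₘ ρ) n

lemma potential_eq_add_comp (R : Kernel X X) (ρ : Measure X) :
    R.potential ρ = ρ + R ∘ₘ R.potential ρ := by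
  ext s hs
  have h : (R ∘ₘ R.potential ρ) s = ∑' n : ℕ, ((R ^ (n + 1) : Kernel X X) ∘ₘ ρ) s := by
    rw [potential, Measure.bind_sum _ _ R.aemeasurable, Measure.sum_apply _ hs]
    simp_rw [pow_succ_comp_measure]
  rw [Measure.add_apply, h, potential, Measure.sum_apply _ hs, tsum_eq_zero_add' ENNReal.summable,
    pow_zero_comp_measure]

/-- Starting at generation `n` only drops the first `n` terms of the series. -/
lemma potential_pow_le (R : Kernel X X) (n : ℕ) (ρ : Measure X) :
    R.potential ((R ^ n : Kernel X X) ∘ₘ ρ) ≤ R.potential ρ := by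
  refine Measure.le_iff.2 fun s hs ↦ ?_
  simp only [potential, Measure.sum_apply _ hs]
  have h (k : ℕ) : (R ^ k : Kernel X X) ∘ₘ ((R ^ n : Kernel X X) ∘ₘ ρ) = (R ^ (k + n) : Kernel X X) ∘ₘ ρ := by
    rw [Measure.comp_assoc, pow_add]
  simp_rw [h]
  exact ENNReal.tsum_comp_le_tsum_of_injective (add_left_injective n) fun k ↦ ((R ^ k : Kernel X X) ∘ₘ ρ) s

/-- Subtracting from a kernel a measure that minorizes it on `C`. -/
lemma exists_residual (P : Kernel X X) {C : Set X} (hC : MeasurableSet C) [IsFiniteMeasure ν]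
    (h : ∀ x ∈ C, ν ≤ P x) : ∃ R : Kernel X X, ∀ ρ : Measure X, P ∘ₘ ρ = R ∘ₘ ρ + ρ C • ν := by
  classical
  let R : Kernel X X :=
    { toFun := fun x ↦ if x ∈ C then P x - ν else P x
      measurable' := by
        refine Measure.measurable_of_measurable_coe _ fun s hs ↦ ?_
        have : (fun x ↦ (if x ∈ C then P x - ν else P x) s)
            = fun x ↦ if x ∈ C then P x s - ν s else P x s := by
          ext x
          split_ifs with hx
          · exact Measure.sub_apply hs (h x hx)
          · rfl
        rw [this]
        exact Measurable.ite hC ((P.measurable_coe hs).sub_const _) (P.measurable_coe hs) }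
  refine ⟨R, fun ρ ↦ ?_⟩
  have hP : P = R + Kernel.piecewise hC (Kernel.const X ν) 0 := by
    ext1 x
    change P x = (if x ∈ C then P x - ν else P x) + Kernel.piecewise hC (Kernel.const X ν) 0 x
    rw [Kernel.piecewise_apply]
    split_ifs with hx
    · rw [Kernel.const_apply, Measure.sub_add_cancel_of_le (h x hx)]
    · simp
  conv_lhs => rw [hP, Measure.add_comp]
  congr 1
  ext s hs
  rw [Measure.bind_apply hs (Kernel.aemeasurable _), Measure.smul_apply, smul_eq_mul, mul_comm,
    ← lintegral_indicator_const hC]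
  refine lintegral_congr fun x ↦ ?_
  rw [Kernel.piecewise_apply]
  by_cases hx : x ∈ C <;> simp [hx]

/-- An invariant measure of an irreducible kernel is the potential of the regeneration measure. -/
lemma Invariant.eq_smul_potential [IsMarkovKernel P] {π : Measure X} [IsFiniteMeasure π]
    (hπ : P.Invariant π) {C : Set X} (hC : MeasurableSet C) [IsFiniteMeasure ν] (hν : ν ≠ 0)
    (hR : ∀ ρ : Measure X, P ∘ₘ ρ = R ∘ₘ ρ + ρ C • ν) (hirr : ∀ x, ∃ n : ℕ, 0 < (P ^ n) x C) :
    π = π C • R.potential ν := by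
  -- Iterating `π = Rπ + π(C)ν` and dropping the remainder `R^N π`.
  have hle (N : ℕ) : π C • ∑ n ∈ Finset.range N, (R ^ n : Kernel X X) ∘ₘ ν ≤ π := by
    have hπR : π = R ∘ₘ π + π C • ν := by rw [← hR]; exact hπ.def.symm
    have hS (N : ℕ) : ∑ n ∈ Finset.range (N + 1), (R ^ n : Kernel X X) ∘ₘ ν
        = R ∘ₘ (∑ n ∈ Finset.range N, (R ^ n : Kernel X X) ∘ₘ ν) + ν := by
      induction N with
      | zero => simpa using pow_zero_comp_measure R ν
      | succ N ih =>
        nth_rewrite 1 [Finset.sum_range_succ, ih]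
        rw [Finset.sum_range_succ _ N, Measure.comp_add,
          pow_succ_comp_measure, add_right_comm]
    induction N with
    | zero => simpa using Measure.zero_le π
    | succ N ih =>
      rw [hS, smul_add, ← Measure.comp_smul]
      conv_rhs => rw [hπR]
      gcongr
      exact Measure.comp_mono_right R ih
  have hle' : π C • R.potential ν ≤ π := by
    refine Measure.le_iff.2 fun s hs ↦ ?_
    rw [Measure.smul_apply, smul_eq_mul, potential, Measure.sum_apply _ hs, ← ENNReal.tsum_mul_left]
    refine ENNReal.tsum_le_of_sum_range_le fun N ↦ ?_
    simpa [Finset.mul_sum] using hle N s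
  have := isFiniteMeasure_of_le π hle'
  set m := π C • R.potential ν with hm
  -- Both `π` and `m` solve `x = Rx + π(C)ν`, so the excess `δ` is `R`-invariant.
  set δ := π - m with hδ
  have hδm : δ + m = π := Measure.sub_add_cancel_of_le hle'
  have : IsFiniteMeasure δ := isFiniteMeasure_of_le π Measure.sub_le
  have hmR : m = π C • ν + R ∘ₘ m := by
    rw [hm, Measure.comp_smul, ← smul_add, ← potential_eq_add_comp]
  have hπR : R ∘ₘ π + π C • ν = π := by rw [← hR]; exact hπ.def
  have hδR : R ∘ₘ δ = δ := by
    rw [← Measure.add_left_inj m, hδm]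
    conv_lhs => rw [hmR]
    conv_rhs => rw [← hπR]
    rw [← hδm, Measure.comp_add, hδm, add_assoc, add_comm (R ∘ₘ m)]
  have hδP := hR δ
  rw [hδR] at hδP
  -- `P` preserves mass, so `Pδ = δ + δ(C)ν` leaves no room for the last term.
  have hδC : δ C = 0 := by
    have h := congrArg (fun μ : Measure X ↦ μ Set.univ) hδP
    simp only [Measure.comp_univ_of_isMarkovKernel, Measure.add_apply, Measure.smul_apply,
      smul_eq_mul] at h
    have h' : δ C * ν Set.univ = 0 := by
      refine (ENNReal.add_right_inj (measure_ne_top δ Set.univ)).1 ?_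
      rw [← h, add_zero]
    exact (mul_eq_zero.1 h').resolve_right (by simpa using hν)
  rw [hδC, zero_smul, add_zero] at hδP
  have hδn (n : ℕ) : (P ^ n : Kernel X X) ∘ₘ δ = δ := by
    induction n with
    | zero => exact pow_zero_comp_measure P δ
    | succ n ih => rw [pow_succ_comp_measure, ih, hδP]
  have hae : ∀ᵐ x ∂δ, ∀ n : ℕ, (P ^ n) x C = 0 := by
    refine ae_all_iff.2 fun n ↦ ?_
    have h : ((P ^ n : Kernel X X) ∘ₘ δ) C = 0 := by rw [hδn, hδC]
    rw [Measure.bind_apply hC (Kernel.aemeasurable _)] at h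
    exact (lintegral_eq_zero_iff ((P ^ n).measurable_coe hC)).1 h
  -- `δ` is now `P`-invariant and never reaches `C`, which is accessible from every state.
  have hδ0 : δ = 0 := by
    rw [← ae_eq_bot, ← Filter.eventually_false_iff_eq_bot]
    filter_upwards [hae] with x hx
    obtain ⟨n, hn⟩ := hirr x
    exact hn.ne' (hx n)
  rw [← hδm, hδ0, zero_add]

end ProbabilityTheory.Kernel

/-! ### Balanced measures and extremality. -/

namespace ControlledMarkovChain

variable {X U : Type*} [MeasurableSpace X] [MeasurableSpace U] {M : ControlledMarkovChain X U}

/-- The state marginal of a measure on the admissible pairs. -/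
noncomputable def stateMarginal (μ : Measure M.Pairs) : Measure X := μ.map fun p ↦ p.1.1

lemma measurable_state : Measurable fun p : M.Pairs ↦ p.1.1 :=
  measurable_fst.comp measurable_subtype_coe

lemma measurable_action : Measurable fun p : M.Pairs ↦ p.1.2 :=
  measurable_snd.comp measurable_subtype_coe

lemma stateMarginal_add (μ ν : Measure M.Pairs) :
    stateMarginal (μ + ν) = stateMarginal μ + stateMarginal ν :=
  Measure.map_add μ ν measurable_state

lemma stateMarginal_smul (c : ℝ≥0∞) (μ : Measure M.Pairs) :
    stateMarginal (c • μ) = c • stateMarginal μ :=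
  Measure.map_smul c μ _

lemma stateMarginal_univ (μ : Measure M.Pairs) : stateMarginal μ Set.univ = μ Set.univ := by
  rw [stateMarginal, Measure.map_apply measurable_state .univ, Set.preimage_univ]

instance (μ : Measure M.Pairs) [IsFiniteMeasure μ] : IsFiniteMeasure (stateMarginal μ) :=
  ⟨by rw [stateMarginal_univ]; exact measure_lt_top μ _⟩

lemma mem_invariantOccupationMeasures_iff {μ : Measure M.Pairs} :
    μ ∈ M.invariantOccupationMeasures ↔
      IsProbabilityMeasure μ ∧ stateMarginal μ = M.trans ∘ₘ μ := by
  refine and_congr_right fun _ ↦ ⟨fun h ↦ ?_, fun h B hB ↦ ?_⟩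
  · ext B hB
    rw [stateMarginal, Measure.map_apply measurable_state hB,
      Measure.bind_apply hB M.trans.aemeasurable]
    exact h B hB
  · rw [← Measure.bind_apply hB M.trans.aemeasurable, ← h, stateMarginal,
      Measure.map_apply measurable_state hB]
    rfl

lemma inv_smul_mem_invariantOccupationMeasures {a : Measure M.Pairs} [IsFiniteMeasure a]
    (ha0 : a Set.univ ≠ 0) (ha : stateMarginal a = M.trans ∘ₘ a) :
    (a Set.univ)⁻¹ • a ∈ M.invariantOccupationMeasures := by
  refine mem_invariantOccupationMeasures_iff.2 ⟨⟨?_⟩, ?_⟩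
  · rw [Measure.smul_apply, smul_eq_mul, ENNReal.inv_mul_cancel ha0 (measure_ne_top a _)]
  · rw [stateMarginal_smul, ha, Measure.comp_smul]

/-- A balanced measure dominated by a multiple of an extreme occupation measure is a multiple
of it. -/
lemma eq_smul_of_add_eq_smul {μ a b : Measure M.Pairs} (hμ : μ ∈ M.extremeOccupationMeasures)
    [IsFiniteMeasure a] [IsFiniteMeasure b] (ha : stateMarginal a = M.trans ∘ₘ a)
    {s : ℝ≥0∞} (hs : s ≠ ∞) (hab : a + b = s • μ) : ∃ t : ℝ≥0∞, a = t • μ := by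
  obtain ⟨hprob, hbal⟩ := mem_invariantOccupationMeasures_iff.1 hμ.1
  by_cases ha0 : a Set.univ = 0
  · exact ⟨0, by simpa using ha0⟩
  by_cases hb0 : b Set.univ = 0
  · refine ⟨s, ?_⟩
    rw [← hab, Measure.measure_univ_eq_zero.1 hb0, add_zero]
  have hb : stateMarginal b = M.trans ∘ₘ b := by
    rw [← Measure.add_right_inj (stateMarginal a), ← stateMarginal_add, hab, stateMarginal_smul,
      hbal, ← Measure.comp_smul, ← hab, Measure.comp_add, ha]
  have hsum : a Set.univ + b Set.univ = s := by
    have := congrArg (fun m : Measure M.Pairs ↦ m Set.univ) hab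
    simpa using this
  have hs0 : s ≠ 0 := by
    rintro rfl
    exact ha0 (add_eq_zero.1 hsum).1
  have hweight (c : ℝ≥0∞) (hc0 : c ≠ 0) (hc : c ≠ ∞) :
      ((c / s).toNNReal : ℝ≥0∞) * c⁻¹ = s⁻¹ := by
    rw [ENNReal.coe_toNNReal (ENNReal.div_ne_top hc hs0), div_eq_mul_inv, mul_right_comm,
      ENNReal.mul_inv_cancel hc0 hc, one_mul]
  have hat := measure_ne_top a Set.univ
  have hbt := measure_ne_top b Set.univ
  -- `μ` is the convex combination of the normalized `a` and `b` with weights `a(univ)/s` and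
  -- `b(univ)/s`.
  have hext := hμ.2 (inv_smul_mem_invariantOccupationMeasures ha0 ha)
    (inv_smul_mem_invariantOccupationMeasures hb0 hb)
    ⟨(a Set.univ / s).toNNReal, (b Set.univ / s).toNNReal,
      ENNReal.toNNReal_pos (ENNReal.div_ne_zero.2 ⟨ha0, hs⟩) (ENNReal.div_ne_top hat hs0),
      ENNReal.toNNReal_pos (ENNReal.div_ne_zero.2 ⟨hb0, hs⟩) (ENNReal.div_ne_top hbt hs0),
      by
        rw [← ENNReal.toNNReal_add (ENNReal.div_ne_top hat hs0) (ENNReal.div_ne_top hbt hs0),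
          ← ENNReal.add_div, hsum, ENNReal.div_self hs0 hs, ENNReal.toNNReal_one],
      by
        rw [ENNReal.smul_def, ENNReal.smul_def, smul_smul, smul_smul, hweight _ ha0 hat,
          hweight _ hb0 hbt, ← smul_add, hab, smul_smul, ENNReal.inv_mul_cancel hs0 hs, one_smul]⟩
  refine ⟨a Set.univ, ?_⟩
  rw [← hext, smul_smul, ENNReal.mul_inv_cancel ha0 hat, one_smul]

/-- Two measures with the same defect of balance, both dominated by a multiple of an extreme
occupation measure `μ`, agree up to multiples of `μ`. -/
lemma smul_add_eq_smul_add {μ o₁ o₂ : Measure M.Pairs} (hμ : μ ∈ M.extremeOccupationMeasures)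
    {s : ℝ≥0∞} (hs : s ≠ ∞) (h₁ : o₁ ≤ s • μ) (h₂ : o₂ ≤ s • μ) {f₁ f₂ g k : Measure X}
    [IsFiniteMeasure f₂]
    (hm₁ : stateMarginal o₁ = f₁ + g) (ht₁ : M.trans ∘ₘ o₁ = f₁ + k)
    (hm₂ : stateMarginal o₂ = f₂ + g) (ht₂ : M.trans ∘ₘ o₂ = f₂ + k) :
    ∃ t : ℝ≥0∞, s • μ + o₁ = t • μ + o₂ := by
  obtain ⟨hprob, hbal⟩ := mem_invariantOccupationMeasures_iff.1 hμ.1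
  have hfin : IsFiniteMeasure (s • μ) := Measure.smul_finite μ hs
  have : IsFiniteMeasure o₁ := isFiniteMeasure_of_le _ h₁
  have : IsFiniteMeasure o₂ := isFiniteMeasure_of_le _ h₂
  have : IsFiniteMeasure (s • μ - o₁) := isFiniteMeasure_of_le _ Measure.sub_le
  have : IsFiniteMeasure (s • μ - o₂) := isFiniteMeasure_of_le _ Measure.sub_le
  have e₁ := Measure.sub_add_cancel_of_le h₁
  have e₂ := Measure.sub_add_cancel_of_le h₂
  set b₁ := s • μ - o₁
  set b₂ := s • μ - o₂
  -- The complement `b₂` of `o₂` in `s • μ` has the opposite defect to `o₂`, so `b₂ + o₁` is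
  -- balanced; its complement in `2s • μ` is `b₁ + o₂`.
  have hb₂ : stateMarginal b₂ + g = M.trans ∘ₘ b₂ + k := by
    rw [← Measure.add_left_inj f₂, add_assoc, add_assoc, add_comm g, add_comm k, ← hm₂, ← ht₂,
      ← stateMarginal_add, ← Measure.comp_add, e₂, stateMarginal_smul, hbal, Measure.comp_smul]
  have hbal' : stateMarginal (b₂ + o₁) = M.trans ∘ₘ (b₂ + o₁) := by
    rw [stateMarginal_add, Measure.comp_add, hm₁, ht₁, add_comm f₁, add_comm f₁, ← add_assoc,
      ← add_assoc, hb₂]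
  obtain ⟨t, ht⟩ := eq_smul_of_add_eq_smul (b := b₁ + o₂) (s := s + s) hμ hbal'
    (ENNReal.add_ne_top.2 ⟨hs, hs⟩) (by rw [add_smul]; nth_rewrite 1 [← e₁]; rw [← e₂]; abel)
  refine ⟨t, ?_⟩
  rw [← ht, ← e₂]
  abel

/-! ### Lifting state measures to pairs through a policy. -/

namespace StationaryPolicy

variable (γ : M.StationaryPolicy)

instance : IsMarkovKernel γ.kernel := γ.isMarkovKernel

instance : IsMarkovKernel M.trans := M.isMarkovKernel_trans

lemma measurableSet_admissible (M : ControlledMarkovChain X U) (x : X) :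
    MeasurableSet (M.admissible x) := measurable_prodMk_left M.measurableSet_graph

instance : IsMarkovKernel γ.pairKernel := by
  refine Kernel.IsMarkovKernel.comapRight _ _ fun x ↦ ?_
  rw [Subtype.range_coe, Kernel.prod_apply, Kernel.id_apply, Measure.dirac_prod,
    Measure.map_apply measurable_prodMk_left M.measurableSet_graph]
  exact γ.apply_admissible x

instance : IsMarkovKernel γ.stateKernel := by
  unfold stateKernel; infer_instance

/-- Restricting to the graph loses no mass, because the policy charges only admissible actions. -/
lemma map_coe_pairKernel (x : X) :
    (γ.pairKernel x).map Subtype.val = (γ.kernel x).map (Prod.mk x) := by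
  have hg := M.measurableSet_graph
  rw [pairKernel, Kernel.comapRight_apply, (MeasurableEmbedding.subtype_coe hg).map_comap,
    Kernel.prod_apply, Kernel.id_apply, Measure.dirac_prod, Subtype.range_coe]
  refine Measure.restrict_eq_self_of_ae_mem ?_
  refine (ae_map_iff measurable_prodMk_left.aemeasurable hg).2 ?_
  exact (prob_compl_eq_zero_iff (measurableSet_admissible M x)).2 (γ.apply_admissible x)

lemma lintegral_pairKernel_comp (ρ : Measure X) {f : X × U → ℝ≥0∞} (hf : Measurable f) :
    ∫⁻ p : M.Pairs, f p ∂(γ.pairKernel ∘ₘ ρ) = ∫⁻ x, ∫⁻ u, f (x, u) ∂γ.kernel x ∂ρ := by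
  refine (Measure.lintegral_bind γ.pairKernel.aemeasurable
    (hf.comp measurable_subtype_coe).aemeasurable).trans (lintegral_congr fun x ↦ ?_)
  refine (lintegral_map hf measurable_subtype_coe).symm.trans ?_
  rw [map_coe_pairKernel, lintegral_map hf measurable_prodMk_left]

lemma stateMarginal_pairKernel_comp (ρ : Measure X) :
    stateMarginal (γ.pairKernel ∘ₘ ρ) = ρ := by
  ext D hD
  have hD' : MeasurableSet (Prod.fst ⁻¹' D : Set (X × U)) := measurable_fst hD
  rw [stateMarginal, Measure.map_apply measurable_state hD,
    ← lintegral_indicator_one (measurable_state hD)]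
  have := lintegral_pairKernel_comp γ ρ (f := (Prod.fst ⁻¹' D : Set (X × U)).indicator 1)
    (measurable_one.indicator hD')
  refine this.trans ?_
  rw [← lintegral_indicator_one hD]
  refine lintegral_congr fun x ↦ ?_
  by_cases hx : x ∈ D <;> simp [Set.indicator, hx]

lemma stateKernel_comp (ρ : Measure X) :
    γ.stateKernel ∘ₘ ρ = M.trans ∘ₘ (γ.pairKernel ∘ₘ ρ) := Measure.comp_assoc.symm

end StationaryPolicy

end ControlledMarkovChain

/-! ### Perturbing one generation of an extreme occupation measure. -/

namespace ControlledMarkovChain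

variable {X U : Type*} [MeasurableSpace X] [MeasurableSpace U] {M : ControlledMarkovChain X U}

namespace StationaryPolicy

variable (γ : M.StationaryPolicy)

/-- The part of the occupation measure of `ρ` with actions in `V`, weighted by the probability of
`Vᶜ`. -/
noncomputable def splitPart (V : Set U) (ρ : Measure X) : Measure M.Pairs :=
  (γ.pairKernel ∘ₘ ρ).withDensity fun p ↦ V.indicator 1 p.1.2 * γ.kernel p.1.1 Vᶜ

lemma splitPart_le (V : Set U) (ρ : Measure X) : γ.splitPart V ρ ≤ γ.pairKernel ∘ₘ ρ := by
  conv_rhs => rw [← withDensity_one (μ := γ.pairKernel ∘ₘ ρ)]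
  refine withDensity_mono (Filter.Eventually.of_forall fun p ↦ ?_)
  refine mul_le_one' ?_ prob_le_one
  exact Set.indicator_le_self' (fun _ _ ↦ zero_le_one) _

lemma splitPart_apply {V W : Set U} {D : Set X} (ρ : Measure X) (hV : MeasurableSet V)
    (hW : MeasurableSet W) (hD : MeasurableSet D) :
    γ.splitPart V ρ {p | p.1.1 ∈ D ∧ p.1.2 ∈ W} =
      ∫⁻ x in D, γ.kernel x (W ∩ V) * γ.kernel x Vᶜ ∂ρ := by
  have hS : MeasurableSet {p : M.Pairs | p.1.1 ∈ D ∧ p.1.2 ∈ W} :=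
    (measurable_state hD).inter (measurable_action hW)
  have hk := γ.kernel.measurable_coe hV.compl
  have hf : Measurable fun q : X × U ↦ D.indicator (1 : X → ℝ≥0∞) q.1 *
      ((W ∩ V).indicator (1 : U → ℝ≥0∞) q.2 * γ.kernel q.1 Vᶜ) :=
    ((measurable_one.indicator hD).comp measurable_fst).mul
      (((measurable_one.indicator (hW.inter hV)).comp measurable_snd).mul (hk.comp measurable_fst))
  rw [splitPart, withDensity_apply _ hS, ← lintegral_indicator hS, ← lintegral_indicator hD]
  refine (lintegral_congr fun p ↦ ?_).trans ((γ.lintegral_pairKernel_comp ρ hf).trans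
    (lintegral_congr fun x ↦ ?_))
  · by_cases h1 : p.1.1 ∈ D <;> by_cases h2 : p.1.2 ∈ W <;> by_cases h3 : p.1.2 ∈ V <;>
      simp [Set.indicator, h1, h2, h3]
  · dsimp only
    rw [lintegral_const_mul _ ((measurable_one.indicator (hW.inter hV)).mul_const _),
      lintegral_mul_const _ (measurable_one.indicator (hW.inter hV)),
      lintegral_indicator_one (hW.inter hV)]
    by_cases h1 : x ∈ D <;> simp [h1]

/-- Both marginals have density `γ(V|x) γ(Vᶜ|x)` with respect to `ρ`; the weight in `splitPart` is
chosen for this symmetry. -/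
lemma stateMarginal_splitPart_compl {V : Set U} (ρ : Measure X) (hV : MeasurableSet V) :
    stateMarginal (γ.splitPart Vᶜ ρ) = stateMarginal (γ.splitPart V ρ) := by
  ext D hD
  have h {W : Set U} (hW : MeasurableSet W) : stateMarginal (γ.splitPart W ρ) D =
      ∫⁻ x in D, γ.kernel x W * γ.kernel x Wᶜ ∂ρ := by
    rw [stateMarginal, Measure.map_apply measurable_state hD]
    have := γ.splitPart_apply ρ hW MeasurableSet.univ hD
    simpa [Set.preimage] using this
  rw [h hV.compl, h hV, compl_compl]
  simp_rw [mul_comm]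

/-- On pairs with action in `V`, one part has mass `∫ γ(V|x) γ(Vᶜ|x) dρ` and the other none. -/
lemma ae_kernel_eq_zero_or_of_splitPart_eq {V : Set U} {ρ : Measure X} (hV : MeasurableSet V)
    (h : γ.splitPart V ρ = γ.splitPart Vᶜ ρ) :
    ∀ᵐ x ∂ρ, γ.kernel x V = 0 ∨ γ.kernel x Vᶜ = 0 := by
  have h₁ := γ.splitPart_apply ρ hV hV MeasurableSet.univ
  have h₂ := γ.splitPart_apply ρ hV.compl hV MeasurableSet.univ
  rw [h, h₂, Set.inter_compl_self, Set.inter_self] at h₁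
  simp only [measure_empty, zero_mul, lintegral_zero, Measure.restrict_univ] at h₁
  have := (lintegral_eq_zero_iff
    ((γ.kernel.measurable_coe hV).mul (γ.kernel.measurable_coe hV.compl))).1 h₁.symm
  filter_upwards [this] with x hx
  exact mul_eq_zero.1 hx

variable {γ} {π ν : Measure X} {R : Kernel X X} {C : Set X}

/-- Perturbing an extreme occupation measure along one generation of the regenerative
representation of its state marginal. -/
lemma ae_pow_kernel_eq_zero_or [IsFiniteMeasure ν] (hν : ν ≠ 0) (hπ : γ.IsInvariantProb π)
    (hext : γ.occupation π ∈ M.extremeOccupationMeasures)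
    (hR : ∀ ρ : Measure X, γ.stateKernel ∘ₘ ρ = R ∘ₘ ρ + ρ C • ν)
    (hrep : π = π C • R.potential ν) (hπC : π C ≠ 0) {V : Set U} (hV : MeasurableSet V) (n : ℕ) :
    ∀ᵐ x ∂((R ^ n : Kernel X X) ∘ₘ ν), γ.kernel x V = 0 ∨ γ.kernel x Vᶜ = 0 := by
  have : IsProbabilityMeasure π := hπ.1
  have hπC' := measure_ne_top π C
  have hpot : R.potential ν = (π C)⁻¹ • π := by
    have h := congrArg ((π C)⁻¹ • ·) hrep
    simp only [smul_smul, ENNReal.inv_mul_cancel hπC hπC', one_smul] at h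
    exact h.symm
  have hinv : (π C)⁻¹ ≠ ∞ := ENNReal.inv_ne_top.2 hπC
  set ρ := (R ^ n : Kernel X X) ∘ₘ ν with hρ
  have hρπ : ρ ≤ (π C)⁻¹ • π := hpot ▸ Kernel.pow_le_potential R n ν
  have : IsFiniteMeasure ((π C)⁻¹ • π) := Measure.smul_finite π hinv
  have : IsFiniteMeasure ρ := isFiniteMeasure_of_le _ hρπ
  -- One transition from the split part is at most `Pρ = Rⁿ⁺¹ν + ρ(C)ν`, and the potential of each
  -- summand is controlled by that of `ν`, which is `π(C)⁻¹ π`.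
  have hle (W : Set U) :
      R.potential (M.trans ∘ₘ γ.splitPart W ρ) ≤ ((1 + ρ C) * (π C)⁻¹) • π := by
    have h1 : M.trans ∘ₘ γ.splitPart W ρ ≤ (R ^ (n + 1) : Kernel X X) ∘ₘ ν + ρ C • ν := by
      rw [Kernel.pow_succ_comp_measure, ← hR, stateKernel_comp]
      exact Measure.comp_mono_right _ (γ.splitPart_le W ρ)
    refine (Kernel.potential_mono R h1).trans ?_
    rw [Kernel.potential_add, Kernel.potential_smul, mul_smul, ← hpot, add_smul, one_smul]
    gcongr
    exact Kernel.potential_pow_le R (n + 1) ν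
  have hs' : (1 + ρ C) * (π C)⁻¹ ≠ ∞ :=
    ENNReal.mul_ne_top (ENNReal.add_ne_top.2 ⟨ENNReal.one_ne_top, measure_ne_top ρ C⟩) hinv
  have hfin : IsFiniteMeasure (((1 + ρ C) * (π C)⁻¹) • π) := Measure.smul_finite π hs'
  set F : Set U → Measure X := fun W ↦ R.potential (M.trans ∘ₘ γ.splitPart W ρ) with hF
  have hFfin (W : Set U) : IsFiniteMeasure (F W) := isFiniteMeasure_of_le _ (hle W)
  have hefin (W : Set U) : IsFiniteMeasure (γ.splitPart W ρ) :=
    isFiniteMeasure_of_le _ (γ.splitPart_le W ρ)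
  have hFeq (W : Set U) : F W = M.trans ∘ₘ γ.splitPart W ρ + R ∘ₘ F W :=
    Kernel.potential_eq_add_comp R _
  -- All mass started by the split part eventually regenerates: compare `P F = R F + F(C)ν` with `F
  -- = Tσ + R F` in total mass, where `σ` is the split part and `F = F W`.
  have hmass (W : Set U) : F W C * ν Set.univ = γ.splitPart W ρ Set.univ := by
    have h1 := congrArg (fun m : Measure X ↦ m Set.univ) (hR (F W))
    have h2 := congrArg (fun m : Measure X ↦ m Set.univ) (hFeq W)
    simp only [Measure.comp_univ_of_isMarkovKernel, Measure.add_apply, Measure.smul_apply,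
      smul_eq_mul] at h1 h2
    have h3 : (R ∘ₘ F W) Set.univ ≠ ∞ := by
      refine ne_top_of_le_ne_top (measure_ne_top (F W) Set.univ) ?_
      rw [h1]
      exact le_self_add
    refine (ENNReal.add_right_inj h3).1 ?_
    rw [← h1, h2, add_comm]
  have hmarg := γ.stateMarginal_splitPart_compl ρ hV
  have hFC : F Vᶜ C = F V C := by
    have h := hmass Vᶜ
    rw [← stateMarginal_univ, hmarg, stateMarginal_univ, ← hmass V] at h
    exact (ENNReal.mul_left_inj (by simpa using hν) (measure_ne_top ν _)).1 h
  -- Marginal and image under `T` share the term `F W`; what remains, the split marginal and `F W C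
  -- • ν`, is the same for `V` and `Vᶜ`.
  have hm (W : Set U) : stateMarginal (γ.pairKernel ∘ₘ F W + γ.splitPart W ρ) =
      F W + stateMarginal (γ.splitPart W ρ) := by
    rw [stateMarginal_add, stateMarginal_pairKernel_comp]
  have ht (W : Set U) : M.trans ∘ₘ (γ.pairKernel ∘ₘ F W + γ.splitPart W ρ) =
      F W + F W C • ν := by
    rw [Measure.comp_add, ← stateKernel_comp, hR]
    rw [add_right_comm, add_comm (R ∘ₘ F W), ← hFeq W]
  -- The first summand bounds the continuation `F W`, the second the split part itself.
  set s := (1 + ρ C) * (π C)⁻¹ + (π C)⁻¹ with hs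
  have hle' (W : Set U) : γ.pairKernel ∘ₘ F W + γ.splitPart W ρ ≤ s • γ.occupation π := by
    rw [hs, add_smul]
    refine add_le_add ?_ ((γ.splitPart_le W ρ).trans ?_)
    · rw [occupation, ← Measure.comp_smul]
      exact Measure.comp_mono_right _ (hle W)
    · rw [occupation, ← Measure.comp_smul]
      exact Measure.comp_mono_right _ hρπ
  obtain ⟨t, htμ⟩ := smul_add_eq_smul_add hext (ENNReal.add_ne_top.2 ⟨hs', hinv⟩) (hle' V)
    (hle' Vᶜ) (hm V) (ht V) (by rw [hm Vᶜ, hmarg]) (by rw [ht Vᶜ, hFC])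
  -- The common split marginal cancels. Lifting this identity through `γ` then reproduces `htμ`
  -- without its split parts.
  have hbase : s • π + F V = t • π + F Vᶜ := by
    have h := congrArg stateMarginal htμ
    simp only [stateMarginal_add, stateMarginal_smul, stateMarginal_pairKernel_comp, occupation,
      hmarg, ← add_assoc] at h
    exact (Measure.add_left_inj _ _ _).1 h
  have hlift := congrArg (fun m : Measure X ↦ γ.pairKernel ∘ₘ m) hbase
  simp only [Measure.comp_add, Measure.comp_smul] at hlift
  have hlfin : IsFiniteMeasure (s • γ.occupation π + γ.pairKernel ∘ₘ F V) := by
    have : IsFiniteMeasure (s • π) := Measure.smul_finite π (ENNReal.add_ne_top.2 ⟨hs', hinv⟩)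
    rw [occupation, ← Measure.comp_smul, ← Measure.comp_add]
    infer_instance
  refine γ.ae_kernel_eq_zero_or_of_splitPart_eq hV ?_
  rw [← Measure.add_right_inj (s • γ.occupation π + γ.pairKernel ∘ₘ F V), add_assoc, htμ,
    ← add_assoc]
  congr 1
  exact hlift.symm

end StationaryPolicy

end ControlledMarkovChain

/-! ### From zero-one laws to determinism; disintegration. -/

namespace ControlledMarkovChain

open MarkovKernel

variable {X U : Type*} [MeasurableSpace X] [MeasurableSpace U] {M : ControlledMarkovChain X U}

namespace StationaryPolicy

variable {γ : M.StationaryPolicy} {π : Measure X}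

/-- An irreducible policy with a `1`-small set of positive irreducibility measure, whose occupation
measure is extreme, is deterministic. No realizability of split kernels is needed: the occupation
measure is perturbed along the regenerative representation of its state marginal. -/
theorem isDeterministic_of_mem_extreme [StandardBorelSpace U] (hπ : γ.IsInvariantProb π)
    {C : Set X} (hC : IsSmall γ.stateKernel 1 C)
    (hpos : HasPosIrreducibilityMeasure γ.stateKernel C)
    (hext : γ.occupation π ∈ M.extremeOccupationMeasures) : γ.IsDeterministic π := by
  have : IsProbabilityMeasure π := hπ.1
  obtain ⟨hCm, ν, hν, hmin⟩ := hC
  obtain ⟨ψ, hψ, hψC⟩ := hpos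
  have hirr : ∀ x, ∃ n : ℕ, 0 < (γ.stateKernel ^ n) x C := hψ.1.2.2.irreducible hCm hψC
  have hmin' : ∀ x ∈ C, ν ≤ γ.stateKernel x := fun x hx ↦
    Measure.le_iff.2 fun D hD ↦ by simpa using hmin x hx D hD
  -- A point of `C` is needed to bound `ν` by a probability measure.
  obtain ⟨x₀, hx₀⟩ : C.Nonempty := nonempty_of_measure_ne_zero hψC.ne'
  have : IsFiniteMeasure ν := isFiniteMeasure_of_le _ (hmin' x₀ hx₀)
  obtain ⟨R, hR⟩ := Kernel.exists_residual γ.stateKernel hCm hmin'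
  have hrep := hπ.2.eq_smul_potential hCm hν hR hirr
  have hπC : π C ≠ 0 := by
    intro h
    rw [h, zero_smul] at hrep
    exact IsProbabilityMeasure.ne_zero π hrep
  have hzero : ∀ V : Set U, MeasurableSet V →
      ∀ᵐ x ∂π, γ.kernel x V = 0 ∨ γ.kernel x Vᶜ = 0 := by
    intro V hV
    rw [hrep]
    refine Measure.ae_smul_measure ?_ _
    rw [Kernel.potential, Measure.ae_sum_iff]
    exact fun n ↦ ae_pow_kernel_eq_zero_or hν hπ hext hR hrep hπC hV n
  -- Countably many `V` allow one exceptional null set for all of them.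
  have hgen : ∀ᵐ x ∂π, ∀ V ∈ MeasurableSpace.countableGeneratingSet U,
      γ.kernel x V = 0 ∨ γ.kernel x Vᶜ = 0 :=
    (ae_ball_iff (MeasurableSpace.countable_countableGeneratingSet)).2 fun V hV ↦
      hzero V (MeasurableSpace.measurableSet_countableGeneratingSet hV)
  filter_upwards [hgen] with x hx
  have := Measure.isZeroOneMeasure_of_generateFrom
    (MeasurableSpace.generateFrom_countableGeneratingSet (α := U)).symm hx
  exact IsZeroOneMeasure.exists_eq_dirac

lemma map_coe_occupation (γ : M.StationaryPolicy) (π : Measure X) [SFinite π] :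
    (γ.occupation π).map Subtype.val = π ⊗ₘ γ.kernel := by
  ext s hs
  rw [Measure.map_apply measurable_subtype_coe hs, Measure.compProd_apply hs, occupation,
    Measure.bind_apply (measurable_subtype_coe hs) γ.pairKernel.aemeasurable]
  refine lintegral_congr fun x ↦ ?_
  rw [← Measure.map_apply measurable_subtype_coe hs, map_coe_pairKernel,
    Measure.map_apply measurable_prodMk_left hs]

end StationaryPolicy

/-- Every measure on the admissible pairs is the occupation measure of a stationary policy. -/
lemma exists_occupation_eq [StandardBorelSpace U] (hΓ : Nonempty M.StationaryPolicy)
    (μ : Measure M.Pairs) [IsFiniteMeasure μ] [NeZero μ] :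
    ∃ γ : M.StationaryPolicy, γ.occupation (stateMarginal μ) = μ := by
  classical
  obtain ⟨γ₀⟩ := hΓ
  have hg := M.measurableSet_graph
  have hemb := MeasurableEmbedding.subtype_coe hg
  have : Nonempty U := by
    obtain ⟨p, -⟩ := nonempty_of_measure_ne_zero
      (Measure.measure_univ_ne_zero.2 (NeZero.ne μ))
    exact ⟨p.1.2⟩
  set μ' : Measure (X × U) := μ.map Subtype.val with hμ'
  have hfst : μ'.fst = stateMarginal μ := by
    rw [Measure.fst, hμ', Measure.map_map measurable_fst measurable_subtype_coe]
    rfl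
  have hdis : stateMarginal μ ⊗ₘ μ'.condKernel = μ' := by
    rw [← hfst]; exact μ'.disintegrate μ'.condKernel
  let S : Set X := {x | μ'.condKernel x (M.admissible x) = 1}
  have hS : MeasurableSet S :=
    Kernel.measurable_kernel_prodMk_left (κ := μ'.condKernel) hg (measurableSet_singleton 1)
  have hSae : ∀ᵐ x ∂stateMarginal μ, x ∈ S := by
    have h : ∀ᵐ q ∂(stateMarginal μ ⊗ₘ μ'.condKernel), q.2 ∈ M.admissible q.1 := by
      rw [hdis, hμ']
      exact (ae_map_iff measurable_subtype_coe.aemeasurable hg).2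
        (Filter.Eventually.of_forall fun p ↦ p.2)
    filter_upwards [Measure.ae_ae_of_ae_compProd h] with x hx
    exact (prob_compl_eq_zero_iff (StationaryPolicy.measurableSet_admissible M x)).1 hx
  -- The conditional kernel is admissible only almost everywhere; `γ₀` repairs it on the null set
  -- `Sᶜ`.
  let γ : M.StationaryPolicy :=
    { kernel := Kernel.piecewise hS μ'.condKernel γ₀.kernel
      isMarkovKernel := inferInstance
      apply_admissible := fun x ↦ by
        rw [Kernel.piecewise_apply]
        split_ifs with hx
        · exact hx
        · exact γ₀.apply_admissible x }
  refine ⟨γ, ?_⟩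
  have hmap : (γ.occupation (stateMarginal μ)).map Subtype.val = μ' := by
    rw [γ.map_coe_occupation, ← hdis]
    refine Measure.compProd_congr ?_
    filter_upwards [hSae] with x hx
    exact (Kernel.piecewise_apply (hs := hS) x).trans (if_pos hx)
  rw [← hemb.comap_map (γ.occupation (stateMarginal μ)), hmap, hμ', hemb.comap_map]

end ControlledMarkovChain

theorem theoremA3 {X U : Type*} [MeasurableSpace X] [StandardBorelSpace X]
    [MeasurableSpace U] [StandardBorelSpace U]
    (M : ControlledMarkovChain X U) (hΓ : Nonempty M.StationaryPolicy)
    (hsmall : M.SmallSetCondition) (hreal : M.RealizabilityCondition) :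
    (∀ (φ : M.StationaryPolicy) (π : Measure X), φ.IsInvariantProb π → φ.IsRandomized π →
      φ.occupation π ∉ M.extremeOccupationMeasures) ∧
    (∀ μ ∈ M.extremeOccupationMeasures, ∃ (γ : M.StationaryPolicy) (π : Measure X),
      γ.IsInvariantProb π ∧ γ.IsDeterministic π ∧ μ = γ.occupation π) := by
  have main : ∀ (φ : M.StationaryPolicy) (π : Measure X), φ.IsInvariantProb π →
      φ.occupation π ∈ M.extremeOccupationMeasures → φ.IsDeterministic π := by
    intro φ π hπ hext
    obtain ⟨ψ, hψ⟩ := hsmall.1 φ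
    have hpos : MarkovKernel.HasPosIrreducibilityMeasure φ.stateKernel Set.univ :=
      ⟨ψ, hψ, Measure.measure_univ_pos.2 hψ.1.2.1⟩
    -- Taking both policies equal to `φ` and `B` the whole space yields one small set.
    obtain ⟨C, -, -, hC, -, hCpos, -⟩ := hsmall.2 φ φ Set.univ .univ hpos hpos
    exact φ.isDeterministic_of_mem_extreme hπ hC hCpos hext
  refine ⟨fun φ π hπ hrand hext ↦ hrand (main φ π hπ hext), fun μ hμ ↦ ?_⟩
  obtain ⟨hprob, hbal⟩ := ControlledMarkovChain.mem_invariantOccupationMeasures_iff.1 hμ.1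
  obtain ⟨γ, hγ⟩ := ControlledMarkovChain.exists_occupation_eq hΓ μ
  have hinv : γ.IsInvariantProb (ControlledMarkovChain.stateMarginal μ) := by
    refine ⟨⟨?_⟩, ?_⟩
    · rw [ControlledMarkovChain.stateMarginal_univ, measure_univ]
    · refine (γ.stateKernel_comp _).trans ?_
      rw [hbal]
      exact congrArg (fun m ↦ M.trans ∘ₘ m) (hbal ▸ hγ)
  exact ⟨γ, _, hinv, main γ _ hinv (hγ.symm ▸ hμ), hγ.symm⟩
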